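/- Let $G$ be a countable group such that no finitely generated subgroup of $G$ has exponential growth. Let $G$ act on a countable set $X$, preserving a linear order (respectively, a circular order) on $X$. Then there exist an action of $G$ by $C^1$ diffeomorphisms on $M=[0,1]$ (respectively, $M=\mathbb S^1$) and a $G$-equivariant, injective, order-preserving map $i\colon X\to M$. Here a linear order is a total order. A circular order on $X$ is a function $c\colon X^3\to\{0,1,-1\}$ with $c(x_1,x_2,x_3)=0$ if and only if $x_i=x_j$ for some $i\neq j$, and $c(x_2,x_3,x_4)-c(x_1,x_3,x_4)+c(x_1,x_2,x_4)-c(x_1,x_2,x_3)=0$ for all $x_1,\dots,x_4\in X$. The action preserves $c$ if $c(gx,gy,gz)=c(x,y,z)$ for all $g\in G$ and $x,y,z\in X$. The map $i\colon X\to\mathbb S^1$ is order-preserving if it carries $c$ to the standard (counterclockwise) circular order of $\mathbb S^1$, that is, if the latter takes the value $c(x,y,z)$ at $(i(x),i(y),i(z))$ for all $x,y,z\in X$. -/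

import Mathlib

open scoped Manifold Pointwise

noncomputable section

/-- The ball of radius `n` around `1` in the group `H`, for the word length with respect to `S`:
all products of `n` elements of `S ∪ S⁻¹ ∪ {1}`. -/
def wordBall {H : Type*} [Group H] (S : Finset H) (n : ℕ) : Set H :=
  (insert (1 : H) ((S : Set H) ∪ (S : Set H)⁻¹)) ^ n

/-- A group has exponential growth if it has a finite generating set whose word balls satisfy
`a ^ n ≤ |B(n)|` for all `n`, for some `a > 1`. By submultiplicativity of `n ↦ |B(n)|` this says
that `lim |B(n)| ^ (1 / n) > 1`, and it does not depend on the finite generating set. -/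
def HasExponentialGrowth (H : Type*) [Group H] : Prop :=
  ∃ S : Finset H, Subgroup.closure (S : Set H) = ⊤ ∧
    ∃ a : ℝ, 1 < a ∧ ∀ n : ℕ, a ^ n ≤ ((wordBall S n).ncard : ℝ)

/-- A circular order on `X`: a function `c : X³ → {0, 1, -1}` which vanishes exactly on the
degenerate triples and satisfies the cocycle relation. -/
structure IsCircularOrder {X : Type*} (c : X → X → X → SignType) : Prop where
  eq_zero_iff : ∀ x₁ x₂ x₃ : X, c x₁ x₂ x₃ = 0 ↔ (x₁ = x₂ ∨ x₂ = x₃ ∨ x₁ = x₃)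
  cocycle : ∀ x₁ x₂ x₃ x₄ : X,
    (c x₂ x₃ x₄ : ℤ) - (c x₁ x₃ x₄ : ℤ) + (c x₁ x₂ x₄ : ℤ) - (c x₁ x₂ x₃ : ℤ) = 0

/-- The standard circular order of the unit circle `Circle ⊆ ℂ`: the orientation of the triangle
`z₁ z₂ z₃`, i.e. the sign of the determinant of `(z₂ - z₁, z₃ - z₁)`. It is `1` if `z₁, z₂, z₃` are
distinct and met in this order when running counterclockwise through the circle, `-1` if they are
distinct and met in the opposite order, and `0` if two of them coincide. -/
def circleOrder (z₁ z₂ z₃ : Circle) : SignType :=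
  SignType.sign (((starRingEnd ℂ) ((z₂ : ℂ) - (z₁ : ℂ)) * ((z₃ : ℂ) - (z₁ : ℂ))).im)

/-- An action of `G` on the manifold `M` (with model `I`) by `C^1` diffeomorphisms. -/
def IsC1Action {G : Type*} [Group G] {E : Type*} [NormedAddCommGroup E] [NormedSpace ℝ E]
    {H : Type*} [TopologicalSpace H] (I : ModelWithCorners ℝ E H)
    {M : Type*} [TopologicalSpace M] [ChartedSpace H M] (ρ : G →* Equiv.Perm M) : Prop :=
  ∀ g : G, ∃ Φ : Diffeomorph I I M M 1, Φ.toEquiv = ρ g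

end

/-! The action is a Denjoy-type blow-up: each `x` becomes an open interval of length `L x`, the
intervals are laid out in the order of `X` with total length 1, and `g` carries the interval of `x`
to that of `g • x`. For these maps to fit together into a `C^1` map it suffices that `L (g • x) / L
x → 1` as `x` leaves finite sets, for every `g`; the growth hypothesis provides such a weight.

Weight (`exists_asymptotically_invariant_weight`): exhaust `G` and `X` by finite sets `S k` and `F
k`, and let `u k x` be the sum of `r k ^ n` over all `n` with `x` in the `n`-ball of `S k` applied
to `F k`, where `r k < 1` increases to 1. Subexponential growth makes `u k` summable. A generator
sends each ball into the next one, so it shrinks `u k` by a factor `r k` at worst. Since `r k < r (k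
+ 1)`, `u k` is negligible against `u (k + 1)` at infinity; in a mixture `∑ c k * u k` only the
nearly invariant tail counts (`exists_weight_of_seq`).

Maps: each interval is parametrised by `s : ℝ` through `blowup`, and `g` keeps `s`, so compositions
agree automatically. The factor `L x` inside the sigmoid places the parameter `s` at distance about
`1 / (π s)` from the right end whatever the length (and likewise on the left). Hence derivatives
equal 1 at the ends, and they are uniformly close to 1 when the length ratio is
(`abs_yoccozDensity_le`), which yields `contDiff_blowupShift`. The intervals are dense, so the group
law extends by continuity.

A circular order is cut at a point `x₀` into a linear one; `g` then acts by the same displacement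
followed by a rotation (`lowerSum_add_lowerSum_comp_smul`). -/

open Filter Topology Set

/-! ### Word balls in groups without exponential growth -/

section Growth

variable {G : Type*} [Group G]

lemma wordBall_finite (S : Finset G) (n : ℕ) : (wordBall S n).Finite := by
  have h : (insert (1 : G) ((S : Set G) ∪ (S : Set G)⁻¹)).Finite :=
    (S.finite_toSet.union S.finite_toSet.inv).insert 1
  rw [wordBall]
  induction n with
  | zero => simp
  | succ n ih => rw [pow_succ]; exact ih.mul h

lemma wordBall_add (S : Finset G) (m n : ℕ) :
    wordBall S (m + n) = wordBall S m * wordBall S n := pow_add _ _ _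

lemma wordBall_mono {S T : Finset G} (hST : S ⊆ T) {m n : ℕ} (hmn : m ≤ n) :
    wordBall S m ⊆ wordBall T n := by
  have h : (S : Set G) ⊆ T := by exact_mod_cast hST
  calc wordBall S m ⊆ wordBall T m := Set.pow_subset_pow_left
        (Set.insert_subset_insert (Set.union_subset_union h (Set.inv_subset_inv.2 h)))
    _ ⊆ wordBall T n := Set.pow_subset_pow_right (Set.mem_insert _ _) hmn

lemma ncard_wordBall_add_le (S : Finset G) (m n : ℕ) :
    (wordBall S (m + n)).ncard ≤ (wordBall S m).ncard * (wordBall S n).ncard := by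
  rw [wordBall_add]
  exact Set.natCard_mul_le

lemma ncard_wordBall_mul_le (S : Finset G) (m q : ℕ) :
    (wordBall S (m * q)).ncard ≤ (wordBall S m).ncard ^ q := by
  induction q with
  | zero => simp [wordBall, ← Set.singleton_one]
  | succ q ih =>
    rw [Nat.mul_succ, pow_succ]
    exact (ncard_wordBall_add_le S _ _).trans (Nat.mul_le_mul_right _ ih)

/-- If the subgroup generated by `S` does not have exponential growth, then some word ball of
radius `n` has fewer than `a ^ n` elements. -/
lemma exists_ncard_wordBall_lt (S : Finset G)
    (hS : ¬ HasExponentialGrowth (Subgroup.closure (S : Set G))) {a : ℝ} (ha : 1 < a) :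
    ∃ n : ℕ, ((wordBall S n).ncard : ℝ) < a ^ n := by
  classical
  by_contra! h
  apply hS
  set H := Subgroup.closure (S : Set G)
  have hinj : Set.InjOn ((↑) : H → G) (((↑) : H → G) ⁻¹' (S : Set G)) :=
    Subtype.val_injective.injOn
  have himg : ((↑) : H → G) '' (((↑) : H → G) ⁻¹' (S : Set G)) = S := by
    rw [Set.image_preimage_eq_iff]
    intro x hx
    exact ⟨⟨x, Subgroup.subset_closure hx⟩, rfl⟩
  refine ⟨S.preimage _ hinj, ?_, a, ha, fun n => (h n).trans ?_⟩
  · rw [Finset.coe_preimage]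
    exact Subgroup.closure_closure_coe_preimage
  -- The inclusion of the subgroup identifies its balls with those computed in `G`.
  · have hball : wordBall S n = H.subtype '' (wordBall (S.preimage _ hinj) n) := by
      rw [wordBall, wordBall, Set.image_pow, Set.image_insert_eq, Set.image_union, Set.image_inv,
        Finset.coe_preimage]
      simp only [Subgroup.coe_subtype, himg, OneMemClass.coe_one]
    rw [hball, Set.ncard_image_of_injective _ H.subtype_injective]

/-- By submultiplicativity, a single radius `N` with fewer than `a ^ N` elements controls all radii:
write `n = N q + m` with `m < N` and absorb the remainder into `C`. -/
lemma exists_ncard_wordBall_le (S : Finset G)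
    (hS : ¬ HasExponentialGrowth (Subgroup.closure (S : Set G))) {a : ℝ} (ha : 1 < a) :
    ∃ C : ℝ, ∀ n : ℕ, ((wordBall S n).ncard : ℝ) ≤ C * a ^ n := by
  obtain ⟨N, hN⟩ := exists_ncard_wordBall_lt S hS ha
  have hN0 : 0 < N := by
    rcases Nat.eq_zero_or_pos N with rfl | h
    · simp [wordBall, ← Set.singleton_one] at hN
    · exact h
  refine ⟨(wordBall S N).ncard, fun n => ?_⟩
  have h1 : (wordBall S n).ncard ≤ (wordBall S N).ncard ^ (n / N) * (wordBall S N).ncard := by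
    conv_lhs => rw [← Nat.div_add_mod n N]
    refine (ncard_wordBall_add_le S _ _).trans
      (Nat.mul_le_mul (ncard_wordBall_mul_le S _ _) ?_)
    exact Set.ncard_le_ncard (wordBall_mono subset_rfl (Nat.mod_lt _ hN0).le)
      (wordBall_finite S N)
  calc ((wordBall S n).ncard : ℝ)
      ≤ ((wordBall S N).ncard : ℝ) ^ (n / N) * (wordBall S N).ncard := by exact_mod_cast h1
    _ ≤ (a ^ N) ^ (n / N) * (wordBall S N).ncard := by gcongr
    _ ≤ a ^ n * (wordBall S N).ncard := by
        rw [← pow_mul]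
        gcongr
        · exact ha.le
        · exact Nat.mul_div_le n N
    _ = _ := mul_comm _ _

lemma summable_pow_mul_ncard_wordBall (S : Finset G)
    (hS : ¬ HasExponentialGrowth (Subgroup.closure (S : Set G))) {r : ℝ} (hr0 : 0 < r)
    (hr1 : r < 1) : Summable fun n : ℕ => r ^ n * ((wordBall S n).ncard : ℝ) := by
  obtain ⟨a, ha1, ha2⟩ := exists_between ((one_lt_inv₀ hr0).2 hr1)
  obtain ⟨C, hC⟩ := exists_ncard_wordBall_le S hS ha1
  have hra : r * a < 1 := by
    calc r * a < r * r⁻¹ := by gcongr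
      _ = 1 := mul_inv_cancel₀ hr0.ne'
  refine Summable.of_nonneg_of_le (fun n => by positivity) (fun n => ?_)
    ((summable_geometric_of_lt_one (by positivity) hra).mul_left C)
  calc r ^ n * ((wordBall S n).ncard : ℝ) ≤ r ^ n * (C * a ^ n) := by
        gcongr
        exact hC n
    _ = C * (r * a) ^ n := by rw [mul_pow]; ring

end Growth

/-! ### Asymptotically invariant weights -/

section Weights

variable {G : Type*} [Group G] {X : Type*} [MulAction G X]

lemma ncard_smul_le_mul {A : Set G} {F : Set X} (hA : A.Finite) (hF : F.Finite) :
    (A • F).ncard ≤ A.ncard * F.ncard := by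
  classical
  lift A to Finset G using hA
  lift F to Finset X using hF
  rw [← Finset.coe_smul, Set.ncard_coe_finset, Set.ncard_coe_finset, Set.ncard_coe_finset]
  exact Finset.card_smul_le

/-- A sequence of summable weights, each negligible with respect to the next one and more and more
invariant, can be mixed into one weight which is asymptotically invariant. -/
lemma exists_weight_of_seq [Nonempty X] (u : ℕ → X → ℝ) (hu0 : ∀ k x, 0 ≤ u k x)
    (hsum : ∀ k, Summable (u k)) (hpos : ∀ x, ∃ k, 0 < u k x)
    (hdom : ∀ k, ∀ η : ℝ, 0 < η → ∀ᶠ x in cofinite, u k x ≤ η * u (k + 1) x)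
    (hinv : ∀ g : G, ∀ δ : ℝ, δ < 1 → ∀ᶠ k in atTop, ∀ x, δ * u k x ≤ u k (g • x)) :
    ∃ L : X → ℝ, (∀ x, 0 < L x) ∧ HasSum L 1 ∧
      ∀ g : G, Tendsto (fun x => L (g • x) / L x) cofinite (𝓝 1) := by
  -- With this normalisation `c k * u k` has total mass at most `2⁻ᵏ`; the `1 +` keeps the
  -- denominator positive even if `u k` vanishes.
  obtain ⟨c, hc⟩ : ∃ c : ℕ → ℝ, ∀ k, c k = (1 / 2) ^ k / (1 + ∑' x, u k x) := ⟨_, fun _ => rfl⟩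
  have hZ : ∀ k, 0 ≤ ∑' x, u k x := fun k => tsum_nonneg (hu0 k)
  have hc0 : ∀ k, 0 < c k := fun k => by have := hZ k; rw [hc]; positivity
  have hprod : Summable fun p : ℕ × X => c p.1 * u p.1 p.2 := by
    have h0 : 0 ≤ fun p : ℕ × X => c p.1 * u p.1 p.2 :=
      fun p => mul_nonneg (hc0 p.1).le (hu0 p.1 p.2)
    have h1 : ∀ k, Summable fun x => c k * u k x := fun k => (hsum k).mul_left (c k)
    refine (summable_prod_of_nonneg h0).2 ⟨h1, ?_⟩
    refine Summable.of_nonneg_of_le (fun k => tsum_nonneg fun x => mul_nonneg (hc0 _).le (hu0 _ _))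
      (fun k => ?_) (summable_geometric_of_lt_one (r := (1 / 2 : ℝ)) (by norm_num) (by norm_num))
    dsimp only
    rw [tsum_mul_left, hc]
    rw [div_mul_eq_mul_div, div_le_iff₀ (by have := hZ k; positivity)]
    gcongr
    linarith
  have hk : ∀ x, Summable fun k => c k * u k x := fun x => hprod.prod_symm.prod_factor x
  set M : X → ℝ := fun x => ∑' k, c k * u k x with hM
  have hterm : ∀ k x, 0 ≤ c k * u k x := fun k x => mul_nonneg (hc0 k).le (hu0 k x)
  have hMsum : Summable M := hprod.prod_symm.prod
  have hle : ∀ k x, c k * u k x ≤ M x := fun k x =>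
    (hk x).le_tsum k (fun j _ => hterm j x)
  have hMpos : ∀ x, 0 < M x := fun x => by
    obtain ⟨k, h⟩ := hpos x
    exact (mul_pos (hc0 k) h).trans_le (hle k x)
  have hsmall : ∀ k, ∀ η : ℝ, 0 < η → ∀ᶠ x in cofinite, c k * u k x ≤ η * M x := by
    intro k η hη
    filter_upwards [hdom k (η * c (k + 1) / c k) (by have := hc0 k; have := hc0 (k + 1); positivity)]
      with x hx
    calc c k * u k x ≤ c k * (η * c (k + 1) / c k * u (k + 1) x) := by
          gcongr
          exact (hc0 k).le
      _ = η * (c (k + 1) * u (k + 1) x) := by have := (hc0 k).ne'; field_simp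
      _ ≤ η * M x := by gcongr; exact hle _ _
  have hlow : ∀ g : G, ∀ δ : ℝ, δ < 1 → ∀ᶠ x in cofinite, δ * M x ≤ M (g • x) := by
    intro g δ hδ
    wlog hδ0 : 0 < δ generalizing δ
    · filter_upwards [this (1 / 2) (by norm_num) (by norm_num)] with x hx
      have := hMpos x
      nlinarith
    obtain ⟨δ', h1, h2⟩ := exists_between hδ
    obtain ⟨K, hK⟩ := eventually_atTop.1 (hinv g δ' h2)
    -- At infinity the `K` head terms together take at most the fraction `1 - δ / δ'` of `M x`. The
    -- tail keeps at least `δ / δ'` of it and loses only a factor `δ'` under `g`.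
    have hη : 0 < (1 - δ / δ') / (K + 1) := by
      have : δ / δ' < 1 := (div_lt_one (hδ0.trans h1)).2 h1
      have : 0 < 1 - δ / δ' := by linarith
      positivity
    have hhead : ∀ᶠ x in cofinite, ∀ k ∈ Finset.range K,
        c k * u k x ≤ (1 - δ / δ') / (K + 1) * M x :=
      (Finset.eventually_all (Finset.range K)).2 fun k _ => hsmall k _ hη
    filter_upwards [hhead] with x hx
    have hsplit := (hk x).sum_add_tsum_nat_add K
    have hsplit' := (hk (g • x)).sum_add_tsum_nat_add K
    have hh : ∑ k ∈ Finset.range K, c k * u k x ≤ (1 - δ / δ') * M x := by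
      calc _ ≤ ∑ k ∈ Finset.range K, (1 - δ / δ') / (K + 1) * M x := Finset.sum_le_sum hx
        _ = K / (K + 1) * ((1 - δ / δ') * M x) := by
            rw [Finset.sum_const, Finset.card_range, nsmul_eq_mul]; ring
        _ ≤ 1 * ((1 - δ / δ') * M x) := by
            have h3 : 0 ≤ 1 - δ / δ' := by
              have : δ / δ' < 1 := (div_lt_one (hδ0.trans h1)).2 h1
              linarith
            have := (hMpos x).le
            gcongr
            rw [div_le_one (by positivity)]
            linarith
        _ = _ := one_mul _
    have ht : δ' * ∑' k, c (k + K) * u (k + K) x ≤ ∑' k, c (k + K) * u (k + K) (g • x) := by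
      rw [← tsum_mul_left]
      refine Summable.tsum_le_tsum (fun k => ?_)
        (((summable_nat_add_iff K).2 (hk x)).mul_left _) ((summable_nat_add_iff K).2 (hk _))
      have := mul_le_mul_of_nonneg_left (hK (k + K) (by omega) x) (hc0 (k + K)).le
      linarith
    have h0 : 0 ≤ ∑ k ∈ Finset.range K, c k * u k (g • x) :=
      Finset.sum_nonneg fun k _ => hterm k _
    have hδ' : 0 < δ' := hδ0.trans h1
    have : δ / δ' * M x ≤ ∑' k, c (k + K) * u (k + K) x := by
      have : M x = ∑ k ∈ Finset.range K, c k * u k x + ∑' k, c (k + K) * u (k + K) x := hsplit.symm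
      linarith
    calc δ * M x = δ' * (δ / δ' * M x) := by field_simp
      _ ≤ δ' * ∑' k, c (k + K) * u (k + K) x := by gcongr
      _ ≤ _ := ht
      _ ≤ M (g • x) := by
          have : M (g • x) = _ := hsplit'.symm
          linarith
  have hMtot : 0 < ∑' x, M x := by
    obtain ⟨x⟩ := ‹Nonempty X›
    exact hMsum.tsum_pos (fun x => (hMpos x).le) x (hMpos x)
  refine ⟨fun x => M x / ∑' x, M x, fun x => div_pos (hMpos x) hMtot, ?_, fun g => ?_⟩
  · simpa [hMtot.ne'] using hMsum.hasSum.div_const (∑' x, M x)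
  simp only [div_div_div_cancel_right₀ hMtot.ne']
  rw [tendsto_order]
  constructor
  · intro a ha
    obtain ⟨δ, h1, h2⟩ := exists_between ha
    filter_upwards [hlow g δ h2] with x hx
    exact h1.trans_le ((le_div_iff₀ (hMpos x)).2 hx)
  · intro a ha
    obtain ⟨δ, h1, h2⟩ := exists_between ha
    have hinj : Tendsto (fun x : X => g • x) cofinite cofinite :=
      (MulAction.injective g).tendsto_cofinite
    -- The upper bound is the lower bound for `g⁻¹` at the point `g • x`.
    filter_upwards [hinj.eventually (hlow g⁻¹ δ⁻¹ (inv_lt_one_of_one_lt₀ h1))] with x hx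
    rw [inv_smul_smul] at hx
    refine lt_of_le_of_lt ((div_le_iff₀ (hMpos x)).2 ?_) h2
    have := mul_le_mul_of_nonneg_left hx (zero_lt_one.trans h1).le
    rwa [← mul_assoc, mul_inv_cancel₀ (by linarith), one_mul] at this

lemma summable_tsum_indicator {r : ℝ} (hr0 : 0 < r) (B : ℕ → Set X) (hB : ∀ n, (B n).Finite)
    (hs : Summable fun n : ℕ => r ^ n * ((B n).ncard : ℝ)) :
    Summable fun x => ∑' n : ℕ, r ^ n * (B n).indicator 1 x := by
  have h : Summable fun p : ℕ × X => r ^ p.1 * (B p.1).indicator (1 : X → ℝ) p.2 := by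
    have h0 : 0 ≤ fun p : ℕ × X => r ^ p.1 * (B p.1).indicator (1 : X → ℝ) p.2 :=
      fun p => mul_nonneg (by positivity) (Set.indicator_nonneg (by simp) _)
    have h1 : ∀ n, Summable fun x => r ^ n * (B n).indicator (1 : X → ℝ) x := by
      intro n
      refine Summable.mul_left (r ^ n) ?_
      refine summable_of_hasFiniteSupport ((hB n).subset ?_)
      exact Set.support_indicator_subset
    refine (summable_prod_of_nonneg h0).2 ⟨h1, ?_⟩
    · refine hs.congr fun n => ?_
      dsimp only
      rw [tsum_mul_left]
      congr 1
      rw [tsum_eq_sum (s := (hB n).toFinset), Finset.sum_congr rfl (g := fun _ => (1 : ℝ)),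
        Finset.sum_const, Set.ncard_eq_toFinset_card _ (hB n)]
      · simp
      · intro x hx
        simp [(hB n).mem_toFinset.1 hx]
      · intro x hx
        exact Set.indicator_of_notMem (by simpa using hx) _
  exact h.prod_symm.prod

/-- A countable set acted on by a countable group whose finitely generated subgroups do not have
exponential growth carries an asymptotically invariant probability weight of full support. -/
theorem exists_asymptotically_invariant_weight [Countable G] [Countable X] [Nonempty X]
    (hG : ∀ H : Subgroup G, H.FG → ¬ HasExponentialGrowth H) :
    ∃ L : X → ℝ, (∀ x, 0 < L x) ∧ HasSum L 1 ∧
      ∀ g : G, Tendsto (fun x => L (g • x) / L x) cofinite (𝓝 1) := by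
  classical
  obtain ⟨e, he⟩ := exists_surjective_nat G
  obtain ⟨f, hf⟩ := exists_surjective_nat X
  set S : ℕ → Finset G := fun k => (Finset.range (k + 1)).image e with hS
  set F : ℕ → Set X := fun k => f '' (Set.Iic k) with hF
  -- Any sequence in `(0, 1)` increasing strictly to 1 would serve.
  obtain ⟨r, hr⟩ : ∃ r : ℕ → ℝ, r = fun k : ℕ => 1 - 1 / ((k : ℝ) + 2) := ⟨_, rfl⟩
  have hr0 : ∀ k, 0 < r k := fun k => by
    rw [hr]
    simp only [sub_pos]
    rw [div_lt_one (by positivity)]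
    have : (0 : ℝ) ≤ k := k.cast_nonneg
    linarith
  have hr1 : ∀ k, r k < 1 := fun k => by
    have : (0 : ℝ) < 1 / (k + 2) := by positivity
    simp only [hr]
    linarith
  have hrlt : ∀ k, r k < r (k + 1) := fun k => by
    simp only [hr]
    push_cast
    gcongr
    linarith
  have hrlim : Tendsto r atTop (𝓝 1) := by
    have h : Tendsto (fun k : ℕ => (1 : ℝ) / (k + 2)) atTop (𝓝 0) := by
      have := (tendsto_one_div_add_atTop_nhds_zero_nat (𝕜 := ℝ)).comp (tendsto_add_atTop_nat 1)
      refine this.congr fun k => ?_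
      simp only [Function.comp]
      push_cast
      ring
    simpa [hr] using h.const_sub 1
  set B : ℕ → ℕ → Set X := fun k n => wordBall (S k) n • F k with hB
  have hBfin : ∀ k n, (B k n).Finite := fun k n =>
    (wordBall_finite _ _).smul ((Set.finite_Iic k).image f)
  have hBcard : ∀ k n, (B k n).ncard ≤ (wordBall (S k) n).ncard * (F k).ncard := fun k n =>
    ncard_smul_le_mul (wordBall_finite _ _) ((Set.finite_Iic k).image f)
  have hB0 : ∀ k, f k ∈ B k 0 := fun k =>
    ⟨1, by simp [wordBall], f k, ⟨k, Set.self_mem_Iic, rfl⟩, one_smul _ _⟩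
  have hS1 : ∀ k, S k ⊆ S (k + 1) := fun k =>
    Finset.image_subset_image (Finset.range_mono (by omega))
  have hBk : ∀ k n, B k n ⊆ B (k + 1) n := fun k n =>
    Set.smul_subset_smul (wordBall_mono (hS1 k) le_rfl)
      (Set.image_mono (Set.Iic_subset_Iic.2 (by omega)))
  have hBn : ∀ k {m n}, m ≤ n → B k m ⊆ B k n := fun k m n h =>
    Set.smul_subset_smul (wordBall_mono subset_rfl h) subset_rfl
  have hBg : ∀ j k n x, j ≤ k → x ∈ B k n → e j • x ∈ B k (n + 1) := by
    rintro j k n x hjk ⟨v, hv, y, hy, rfl⟩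
    refine ⟨e j * v, ?_, y, hy, mul_smul _ _ _⟩
    rw [add_comm n 1, wordBall_add]
    refine Set.mul_mem_mul ?_ hv
    rw [wordBall, pow_one]
    refine Or.inr (Or.inl ?_)
    simp only [hS, Finset.coe_image, Finset.coe_range]
    exact ⟨j, by simpa using Nat.lt_succ_of_le hjk, rfl⟩
  set u : ℕ → X → ℝ := fun k x => ∑' n : ℕ, r k ^ n * (B k n).indicator 1 x with hu
  have hind0 : ∀ (A : Set X) x, 0 ≤ A.indicator (1 : X → ℝ) x :=
    fun A x => Set.indicator_nonneg (by simp) _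
  have hind1 : ∀ (A : Set X) x, A.indicator (1 : X → ℝ) x ≤ 1 :=
    fun A x => Set.indicator_le_self' (by simp) _
  have hterm : ∀ k x n, 0 ≤ r k ^ n * (B k n).indicator (1 : X → ℝ) x := fun k x n =>
    mul_nonneg (pow_nonneg (hr0 k).le _) (hind0 _ _)
  have hus : ∀ k x, Summable fun n : ℕ => r k ^ n * (B k n).indicator (1 : X → ℝ) x := fun k x =>
    Summable.of_nonneg_of_le (hterm k x)
      (fun n => mul_le_of_le_one_right (pow_nonneg (hr0 k).le _) (hind1 _ _))
      (summable_geometric_of_lt_one (hr0 k).le (hr1 k))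
  have hu0 : ∀ k x, 0 ≤ u k x := fun k x => tsum_nonneg (hterm k x)
  clear_value B
  refine exists_weight_of_seq u hu0 (fun k => ?_) (fun x => ?_) (fun k η hη => ?_)
    (fun g δ hδ => ?_)
  · refine summable_tsum_indicator (hr0 k) _ (hBfin k) ?_
    have hgr := summable_pow_mul_ncard_wordBall (S k) (hG _ ⟨S k, rfl⟩) (hr0 k) (hr1 k)
    refine Summable.of_nonneg_of_le (fun n => mul_nonneg (pow_nonneg (hr0 k).le _) (by positivity))
      (fun n => ?_) (hgr.mul_right ((F k).ncard : ℝ))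
    rw [mul_assoc]
    refine mul_le_mul_of_nonneg_left ?_ (pow_nonneg (hr0 k).le _)
    exact_mod_cast hBcard k n
  · obtain ⟨k, rfl⟩ := hf x
    refine ⟨k, (hus k _).tsum_pos (hterm k _) 0 ?_⟩
    simp [hB0 k]
  · have hq : r k / r (k + 1) < 1 := (div_lt_one (hr0 _)).2 (hrlt k)
    have hq0 : 0 < r k / r (k + 1) := div_pos (hr0 _) (hr0 _)
    obtain ⟨N, hN⟩ := exists_pow_lt_of_lt_one hη hq
    -- Outside the finite set `B k N` only the indices `n > N` contribute, and there the ratio of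
    -- the two terms is at most `(r k / r (k + 1)) ^ N < η`.
    filter_upwards [(hBfin k N).compl_mem_cofinite] with x hx
    rw [← tsum_mul_left]
    refine Summable.tsum_le_tsum (fun n => ?_) (hus k x) ((hus (k + 1) x).mul_left η)
    by_cases hxn : x ∈ B k n
    · have hNn : N ≤ n := by
        by_contra! h
        exact hx (hBn k h.le hxn)
      rw [Set.indicator_of_mem hxn, Set.indicator_of_mem (hBk k n hxn)]
      simp only [Pi.one_apply, mul_one]
      have h1 : (r k / r (k + 1)) ^ n ≤ η :=
        (pow_le_pow_of_le_one hq0.le hq.le hNn).trans hN.le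
      rwa [div_pow, div_le_iff₀ (pow_pos (hr0 _) _)] at h1
    · rw [Set.indicator_of_notMem hxn, mul_zero]
      exact mul_nonneg hη.le (hterm _ _ _)
  · obtain ⟨j, rfl⟩ := he g
    filter_upwards [hrlim.eventually (lt_mem_nhds hδ), eventually_ge_atTop j] with k hk hjk x
    refine (mul_le_mul_of_nonneg_right hk.le (hu0 k x)).trans ?_
    rw [hu]
    simp only
    -- Drop the term `n = 0` at `e j • x` and compare its term `n + 1` with the term `n` at `x`.
    rw [← tsum_mul_left, ← (hus k (e j • x)).sum_add_tsum_nat_add 1]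
    refine le_add_of_nonneg_of_le (Finset.sum_nonneg fun n _ => hterm _ _ _) ?_
    refine Summable.tsum_le_tsum (fun n => ?_) ((hus k x).mul_left _)
      ((summable_nat_add_iff 1).2 (hus k _))
    by_cases hxn : x ∈ B k n
    · rw [Set.indicator_of_mem hxn, Set.indicator_of_mem (hBg j k n x hjk hxn)]
      simp only [Pi.one_apply, mul_one]
      rw [pow_succ']
    · rw [Set.indicator_of_notMem hxn, mul_zero, mul_zero]
      exact hterm _ _ _

end Weights

/-! ### The arctangent parametrisation of the unit interval -/

section Sigmoid

/-- The cumulative distribution function of the Cauchy law, an increasing diffeomorphism from `ℝ`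
onto `(0, 1)`. -/
noncomputable def arctanSigmoid (s : ℝ) : ℝ := Real.arctan s / Real.pi + 1 / 2

lemma arctanSigmoid_pos (s : ℝ) : 0 < arctanSigmoid s := by
  have h := (div_lt_div_iff_of_pos_right Real.pi_pos).2 (Real.neg_pi_div_two_lt_arctan s)
  have h2 : -(Real.pi / 2) / Real.pi = -(1 / 2) := by field_simp
  rw [arctanSigmoid]
  linarith

lemma arctanSigmoid_lt_one (s : ℝ) : arctanSigmoid s < 1 := by
  have h := (div_lt_div_iff_of_pos_right Real.pi_pos).2 (Real.arctan_lt_pi_div_two s)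
  have h2 : Real.pi / 2 / Real.pi = 1 / 2 := by field_simp
  rw [arctanSigmoid]
  linarith

lemma exists_arctanSigmoid_eq {u : ℝ} (h0 : 0 < u) (h1 : u < 1) : ∃ s, arctanSigmoid s = u := by
  have hpi := Real.pi_pos
  refine ⟨Real.tan (Real.pi * (u - 1 / 2)), ?_⟩
  rw [arctanSigmoid, Real.arctan_tan (by nlinarith) (by nlinarith)]
  field_simp
  ring

lemma hasDerivAt_arctanSigmoid (s : ℝ) :
    HasDerivAt arctanSigmoid (1 / (1 + s ^ 2) / Real.pi) s :=
  ((Real.hasDerivAt_arctan s).div_const _).add_const _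

lemma tendsto_arctanSigmoid_atBot : Tendsto arctanSigmoid atBot (𝓝 0) := by
  have h := (tendsto_nhds_of_tendsto_nhdsWithin Real.tendsto_arctan_atBot).div_const Real.pi
  have h2 := h.add_const (1 / 2 : ℝ)
  have h3 : -(Real.pi / 2) / Real.pi + 1 / 2 = 0 := by field_simp; norm_num
  rwa [h3] at h2

lemma tendsto_arctanSigmoid_atTop : Tendsto arctanSigmoid atTop (𝓝 1) := by
  have h := (tendsto_nhds_of_tendsto_nhdsWithin Real.tendsto_arctan_atTop).div_const Real.pi
  have h2 := h.add_const (1 / 2 : ℝ)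
  have h3 : Real.pi / 2 / Real.pi + 1 / 2 = 1 := by field_simp; norm_num
  rwa [h3] at h2

end Sigmoid

/-! ### Yoccoz-type interval maps -/

section YoccozDensity

/-- On `[0, 1]`, the derivative minus `1` of the map `[0, 1] → [0, κ]` which is conjugate to the
identity of `ℝ` through `arctanSigmoid` and `s ↦ κ * arctanSigmoid (κ * s)`; zero elsewhere. -/
noncomputable def yoccozDensity (κ u : ℝ) : ℝ :=
  (κ ^ 2 - 1) * Real.sin (Real.pi * max 0 (min u 1)) ^ 2 /
    (Real.sin (Real.pi * max 0 (min u 1)) ^ 2 + κ ^ 2 * Real.cos (Real.pi * max 0 (min u 1)) ^ 2)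

lemma min_le_sin_sq_add (κ v : ℝ) :
    min 1 (κ ^ 2) ≤ Real.sin v ^ 2 + κ ^ 2 * Real.cos v ^ 2 := by
  have h := Real.sin_sq_add_cos_sq v
  rcases min_cases 1 (κ ^ 2) with ⟨h1, h2⟩ | ⟨h1, h2⟩ <;> rw [h1] <;>
    nlinarith [sq_nonneg (Real.sin v), sq_nonneg (Real.cos v)]

lemma min_one_sq_pos {κ : ℝ} (hκ : 0 < κ) : 0 < min 1 (κ ^ 2) := lt_min one_pos (by positivity)

lemma continuous_yoccozDensity {κ : ℝ} (hκ : 0 < κ) : Continuous (yoccozDensity κ) := by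
  unfold yoccozDensity
  refine Continuous.div (by fun_prop) (by fun_prop) fun u => ?_
  exact ((min_one_sq_pos hκ).trans_le (min_le_sin_sq_add _ _)).ne'

lemma yoccozDensity_of_nonpos (κ : ℝ) {u : ℝ} (hu : u ≤ 0) : yoccozDensity κ u = 0 := by
  rw [yoccozDensity, min_eq_left (by linarith), max_eq_left hu]
  simp

lemma yoccozDensity_of_one_le (κ : ℝ) {u : ℝ} (hu : 1 ≤ u) : yoccozDensity κ u = 0 := by
  rw [yoccozDensity, min_eq_right hu]
  simp

lemma abs_yoccozDensity_le {κ : ℝ} (hκ : 0 < κ) (u : ℝ) :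
    |yoccozDensity κ u| ≤ |κ ^ 2 - 1| / min 1 (κ ^ 2) := by
  have h0 := min_one_sq_pos hκ
  have h1 := min_le_sin_sq_add κ (Real.pi * max 0 (min u 1))
  rw [yoccozDensity, abs_div, abs_mul, abs_of_pos (h0.trans_le h1), abs_of_nonneg (sq_nonneg (Real.sin _))]
  refine div_le_div₀ (abs_nonneg _) ?_ h0 h1
  exact mul_le_of_le_one_right (abs_nonneg _) (Real.sin_sq_le_one _)

/-- The fraction on the right is the quotient of the speeds of `s ↦ κ * arctanSigmoid (κ * s)` and
`arctanSigmoid`. It tends to 1 as `s → ±∞`, so the density vanishes at the ends. -/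
lemma yoccozDensity_arctanSigmoid {κ : ℝ} (hκ : 0 < κ) (s : ℝ) :
    yoccozDensity κ (arctanSigmoid s) = κ ^ 2 * (1 + s ^ 2) / (1 + (κ * s) ^ 2) - 1 := by
  have hp : Real.pi * arctanSigmoid s = Real.arctan s + Real.pi / 2 := by
    rw [arctanSigmoid]
    field_simp
  rw [yoccozDensity, min_eq_left (arctanSigmoid_lt_one s).le,
    max_eq_right (arctanSigmoid_pos s).le, hp, Real.sin_add_pi_div_two, Real.cos_add_pi_div_two,
    neg_sq, Real.cos_sq_arctan, Real.sin_sq, Real.cos_sq_arctan]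
  have h1 : (1 + s ^ 2) ≠ 0 := by positivity
  have h2 : (1 + (κ * s) ^ 2) ≠ 0 := by positivity
  have h3 : 1 / (1 + s ^ 2) + κ ^ 2 * (1 - 1 / (1 + s ^ 2)) = (1 + (κ * s) ^ 2) / (1 + s ^ 2) := by
    field_simp
    ring
  rw [h3]
  field_simp
  ring

/-- The primitive of `yoccozDensity κ` that vanishes at `0`. -/
noncomputable def yoccozShift (κ u : ℝ) : ℝ := ∫ v in (0 : ℝ)..u, yoccozDensity κ v

lemma hasDerivAt_yoccozShift {κ : ℝ} (hκ : 0 < κ) (u : ℝ) :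
    HasDerivAt (yoccozShift κ) (yoccozDensity κ u) u :=
  ((continuous_yoccozDensity hκ).integral_hasStrictDerivAt 0 u).hasDerivAt

lemma yoccozShift_of_nonpos (κ : ℝ) {u : ℝ} (hu : u ≤ 0) : yoccozShift κ u = 0 := by
  rw [yoccozShift, intervalIntegral.integral_congr (g := fun _ => (0 : ℝ))]
  · simp
  · intro v hv
    rw [uIcc_of_ge hu] at hv
    exact yoccozDensity_of_nonpos κ hv.2

/-- The two sides have the same derivative in `s` and both tend to 0 as `s → -∞`. -/
lemma yoccozShift_arctanSigmoid {κ : ℝ} (hκ : 0 < κ) (s : ℝ) :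
    yoccozShift κ (arctanSigmoid s) = κ * arctanSigmoid (κ * s) - arctanSigmoid s := by
  set D : ℝ → ℝ := fun s =>
    yoccozShift κ (arctanSigmoid s) - (κ * arctanSigmoid (κ * s) - arctanSigmoid s) with hD
  have hder : ∀ s, HasDerivAt D 0 s := by
    intro s
    have h1 := (hasDerivAt_yoccozShift hκ (arctanSigmoid s)).comp s (hasDerivAt_arctanSigmoid s)
    have h2 := ((hasDerivAt_arctanSigmoid (κ * s)).comp s
      ((hasDerivAt_id s).const_mul κ)).const_mul κ
    have h3 := h1.sub (h2.sub (hasDerivAt_arctanSigmoid s))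
    refine h3.congr_deriv ?_
    rw [yoccozDensity_arctanSigmoid hκ]
    have h1 : (1 + s ^ 2) ≠ 0 := by positivity
    have h2 : (1 + (κ * s) ^ 2) ≠ 0 := by positivity
    have := Real.pi_pos.ne'
    field_simp
    ring
  have hconst : ∀ s', D s' = D s := fun s' =>
    is_const_of_deriv_eq_zero (fun t => (hder t).differentiableAt) (fun t => (hder t).deriv) s' s
  have hlim : Tendsto D atBot (𝓝 0) := by
    have hκs : Tendsto (fun s : ℝ => κ * s) atBot atBot := tendsto_id.const_mul_atBot hκ
    have h1 := ((hasDerivAt_yoccozShift hκ 0).continuousAt.tendsto).comp tendsto_arctanSigmoid_atBot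
    have h2 := (tendsto_arctanSigmoid_atBot.comp hκs).const_mul κ
    have h3 := h1.sub (h2.sub tendsto_arctanSigmoid_atBot)
    rw [yoccozShift_of_nonpos κ le_rfl] at h3
    simpa using h3
  have h0 : D s = 0 := by
    refine tendsto_nhds_unique ?_ hlim
    exact tendsto_const_nhds.congr fun s' => (hconst s').symm
  exact sub_eq_zero.1 h0

lemma yoccozShift_of_one_le {κ : ℝ} (hκ : 0 < κ) {u : ℝ} (hu : 1 ≤ u) :
    yoccozShift κ u = κ - 1 := by
  have h1 : yoccozShift κ 1 = κ - 1 := by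
    have hκs : Tendsto (fun s : ℝ => κ * s) atTop atTop := tendsto_id.const_mul_atTop hκ
    have h1 := ((hasDerivAt_yoccozShift hκ 1).continuousAt.tendsto).comp tendsto_arctanSigmoid_atTop
    have h2 := ((tendsto_arctanSigmoid_atTop.comp hκs).const_mul κ).sub tendsto_arctanSigmoid_atTop
    rw [mul_one] at h2
    exact tendsto_nhds_unique h1 (h2.congr fun s => (yoccozShift_arctanSigmoid hκ s).symm)
  have hc := continuous_yoccozDensity hκ
  rw [← h1, yoccozShift, yoccozShift, ← intervalIntegral.integral_add_adjacent_intervals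
    (hc.intervalIntegrable 0 1) (hc.intervalIntegrable 1 u), add_eq_left,
    intervalIntegral.integral_congr (g := fun _ => (0 : ℝ))]
  · simp
  · intro v hv
    rw [uIcc_of_le hu] at hv
    exact yoccozDensity_of_one_le κ hv.1

lemma abs_yoccozShift_le {κ : ℝ} (hκ : 0 < κ) (u : ℝ) : |yoccozShift κ u| ≤ κ + 1 := by
  rcases le_or_gt u 0 with h0 | h0
  · rw [yoccozShift_of_nonpos κ h0, abs_zero]
    positivity
  rcases le_or_gt 1 u with h1 | h1
  · rw [yoccozShift_of_one_le hκ h1, abs_le]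
    constructor <;> linarith
  obtain ⟨s, rfl⟩ := exists_arctanSigmoid_eq h0 h1
  rw [yoccozShift_arctanSigmoid hκ, abs_le]
  have h2 := arctanSigmoid_pos (κ * s)
  have h3 := arctanSigmoid_lt_one (κ * s)
  constructor <;> nlinarith

end YoccozDensity

/-! ### Blowing up points to intervals, and the displacement maps -/

section Blowup

variable {X : Type*} [LinearOrder X] {L L' : X → ℝ}

/-- The total weight of the points below `x`. -/
noncomputable def lowerSum (L : X → ℝ) (x : X) : ℝ := ∑' y, (Iio x).indicator L y

/-- The lexicographically ordered map `X × ℝ → ℝ` whose image is a disjoint union of open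
intervals `(lowerSum L x, lowerSum L x + L x)`. -/
noncomputable def blowup (L : X → ℝ) (x : X) (s : ℝ) : ℝ :=
  lowerSum L x + L x * arctanSigmoid (L x * s)

lemma lowerSum_nonneg (hL : ∀ x, 0 < L x) (x : X) : 0 ≤ lowerSum L x :=
  tsum_nonneg fun _ => indicator_nonneg (fun y _ => (hL y).le) _

lemma lowerSum_add_le_of_lt (hL : ∀ x, 0 < L x) (hs : Summable L) {x y : X} (h : x < y) :
    lowerSum L x + L x ≤ lowerSum L y := by
  have h1 : HasSum (fun z => (Iio x).indicator L z + if z = x then L x else 0)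
      (lowerSum L x + L x) := (hs.indicator _).hasSum.add (hasSum_ite_eq x _)
  refine hasSum_le (fun z => ?_) h1 (hs.indicator (Iio y)).hasSum
  by_cases hzx : z = x
  · subst hzx
    simp [h]
  · by_cases hz : z < x
    · simp [hz, hzx, hz.trans h]
    · simpa [hz, hzx] using indicator_nonneg (fun y _ => (hL y).le) z

lemma lowerSum_add_le {T : ℝ} (hL : ∀ x, 0 < L x) (hs : HasSum L T) (x : X) :
    lowerSum L x + L x ≤ T := by
  have h1 : HasSum (fun z => (Iio x).indicator L z + if z = x then L x else 0)
      (lowerSum L x + L x) := (hs.summable.indicator _).hasSum.add (hasSum_ite_eq x _)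
  refine hasSum_le (fun z => ?_) h1 hs
  by_cases hzx : z = x
  · subst hzx
    simp
  · simpa [hzx] using indicator_le_self' (fun y _ => (hL y).le) z

lemma lowerSum_lt_blowup (hL : ∀ x, 0 < L x) (x : X) (s : ℝ) : lowerSum L x < blowup L x s :=
  lt_add_of_pos_right _ (mul_pos (hL x) (arctanSigmoid_pos _))

lemma blowup_lt (hL : ∀ x, 0 < L x) (x : X) (s : ℝ) : blowup L x s < lowerSum L x + L x := by
  rw [blowup]
  gcongr
  exact mul_lt_of_lt_one_right (hL x) (arctanSigmoid_lt_one _)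

lemma blowup_pos (hL : ∀ x, 0 < L x) (x : X) (s : ℝ) : 0 < blowup L x s :=
  (lowerSum_nonneg hL x).trans_lt (lowerSum_lt_blowup hL x s)

lemma blowup_lt_of_hasSum {T : ℝ} (hL : ∀ x, 0 < L x) (hs : HasSum L T) (x : X) (s : ℝ) :
    blowup L x s < T := (blowup_lt hL x s).trans_le (lowerSum_add_le hL hs x)

lemma blowup_lt_blowup (hL : ∀ x, 0 < L x) (hs : Summable L) {x y : X} (h : x < y) (s t : ℝ) :
    blowup L x s < blowup L y t :=
  (blowup_lt hL x s).trans_le ((lowerSum_add_le_of_lt hL hs h).trans (lowerSum_lt_blowup hL y t).le)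

lemma exists_blowup_eq (hL : ∀ x, 0 < L x) {x : X} {t : ℝ} (h0 : lowerSum L x < t)
    (h1 : t < lowerSum L x + L x) : ∃ s, blowup L x s = t := by
  have hx := hL x
  obtain ⟨s, hs⟩ := exists_arctanSigmoid_eq (u := (t - lowerSum L x) / L x)
    (div_pos (by linarith) hx) ((div_lt_one hx).2 (by linarith))
  refine ⟨s / L x, ?_⟩
  rw [blowup, mul_div_cancel₀ _ hx.ne', hs]
  field_simp
  ring

/-- The disjoint intervals have total length 1 inside `[0, 1]`, so no gap of positive length is
left. -/
lemma Icc_subset_closure_range_blowup [Countable X] (hL : ∀ x, 0 < L x) (hs : HasSum L 1) :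
    Icc (0 : ℝ) 1 ⊆ closure (range fun p : X × ℝ => blowup L p.1 p.2) := by
  intro t ht
  rw [Metric.mem_closure_iff]
  intro ε hε
  by_contra! hfar
  set I : X → Set ℝ := fun x => Ioo (lowerSum L x) (lowerSum L x + L x) with hI
  have hdisj : Pairwise (Function.onFun Disjoint I) := by
    intro x y hxy
    rw [Function.onFun, Set.disjoint_left]
    rintro u ⟨h1, h2⟩ ⟨h3, h4⟩
    rcases lt_or_gt_of_ne hxy with h | h
    · linarith [lowerSum_add_le_of_lt hL hs.summable h]
    · linarith [lowerSum_add_le_of_lt hL hs.summable h]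
  have hvol : MeasureTheory.volume (⋃ x, I x) = 1 := by
    rw [MeasureTheory.measure_iUnion hdisj fun x => measurableSet_Ioo]
    simp only [hI, Real.volume_Ioo, add_sub_cancel_left]
    rw [← ENNReal.ofReal_tsum_of_nonneg (fun x => (hL x).le) hs.summable, hs.tsum_eq,
      ENNReal.ofReal_one]
  -- Intersecting with `[0, 1]` keeps positive length even when `t` is an endpoint.
  have hab : max 0 (t - ε) < min 1 (t + ε) :=
    max_lt (lt_min one_pos (by linarith [ht.1])) (lt_min (by linarith [ht.2]) (by linarith))
  have hd : Disjoint (⋃ x, I x) (Ioo (max 0 (t - ε)) (min 1 (t + ε))) := by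
    rw [Set.disjoint_left]
    rintro u hu ⟨h1, h2⟩
    obtain ⟨x, hx⟩ := mem_iUnion.1 hu
    obtain ⟨s, rfl⟩ := exists_blowup_eq hL hx.1 hx.2
    have h3 := hfar _ ⟨(x, s), rfl⟩
    rw [Real.dist_eq, le_abs] at h3
    have h4 := (le_max_right _ _).trans_lt h1
    have h5 := h2.trans_le (min_le_right _ _)
    rcases h3 with h3 | h3 <;> dsimp only at h3 <;> linarith
  have hsub : (⋃ x, I x) ∪ Ioo (max 0 (t - ε)) (min 1 (t + ε)) ⊆ Icc 0 1 := by
    refine union_subset (iUnion_subset fun x u hu => ?_) fun u hu => ?_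
    · exact ⟨(lowerSum_nonneg hL x).trans hu.1.le, hu.2.le.trans (lowerSum_add_le hL hs x)⟩
    · exact ⟨(le_max_left _ _).trans hu.1.le, hu.2.le.trans (min_le_left _ _)⟩
  have hle := MeasureTheory.measure_mono (μ := MeasureTheory.volume) hsub
  rw [MeasureTheory.measure_union hd measurableSet_Ioo, hvol, Real.volume_Ioo, Real.volume_Icc,
    sub_zero, ENNReal.ofReal_one] at hle
  have hpos : 0 < ENNReal.ofReal (min 1 (t + ε) - max 0 (t - ε)) :=
    ENNReal.ofReal_pos.2 (sub_pos.2 hab)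
  exact absurd hle (not_le.2 (ENNReal.lt_add_right ENNReal.one_ne_top hpos.ne'))

/-- The displacement of the map that carries `blowup L x s` to `blowup L' x s`. -/
noncomputable def blowupShift (L L' : X → ℝ) (t : ℝ) : ℝ :=
  ∑' x, L x * yoccozShift (L' x / L x) ((t - lowerSum L x) / L x)

lemma blowupShift_of_nonpos (hL : ∀ x, 0 < L x) {t : ℝ} (ht : t ≤ 0) : blowupShift L L' t = 0 := by
  rw [blowupShift, ← tsum_zero (α := ℝ) (β := X)]
  congr 1
  ext x
  rw [yoccozShift_of_nonpos, mul_zero]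
  exact div_nonpos_of_nonpos_of_nonneg (by linarith [lowerSum_nonneg hL x]) (hL x).le

lemma blowupShift_of_one_le (hL : ∀ x, 0 < L x) (hL' : ∀ x, 0 < L' x) (hs : HasSum L 1)
    (hs' : HasSum L' 1) {t : ℝ} (ht : 1 ≤ t) : blowupShift L L' t = 0 := by
  rw [← sub_self (1 : ℝ), ← (hs'.sub hs).tsum_eq, blowupShift]
  congr 1
  ext x
  have hx := hL x
  rw [yoccozShift_of_one_le (div_pos (hL' x) hx)]
  · field_simp
  · rw [one_le_div hx]
    linarith [lowerSum_add_le hL hs x]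

/-- At a point in the interval of `x`, each `y < x` has completed its displacement `L' y - L y`,
each `y > x` has not started, and `x` contributes the change of position inside its own interval. -/
lemma blowup_add_blowupShift (hL : ∀ x, 0 < L x) (hL' : ∀ x, 0 < L' x) (hs : Summable L)
    (hs' : Summable L') (x : X) (s : ℝ) :
    blowup L x s + blowupShift L L' (blowup L x s) = blowup L' x s := by
  have h1 : HasSum (fun z => (Iio x).indicator L' z - (Iio x).indicator L z +
      if z = x then L' x * arctanSigmoid (L' x * s) - L x * arctanSigmoid (L x * s) else 0)
      (lowerSum L' x - lowerSum L x +
        (L' x * arctanSigmoid (L' x * s) - L x * arctanSigmoid (L x * s))) :=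
    ((hs'.indicator _).hasSum.sub (hs.indicator _).hasSum).add (hasSum_ite_eq x _)
  have h2 : blowupShift L L' (blowup L x s) = lowerSum L' x - lowerSum L x +
      (L' x * arctanSigmoid (L' x * s) - L x * arctanSigmoid (L x * s)) := by
    rw [← h1.tsum_eq, blowupShift]
    congr 1
    ext y
    have hy := hL y
    rcases lt_trichotomy y x with h | rfl | h
    · rw [yoccozShift_of_one_le (div_pos (hL' y) hy)]
      · simp [h, h.ne]
        field_simp
      · rw [one_le_div hy]
        linarith [lowerSum_add_le_of_lt hL hs h, lowerSum_lt_blowup hL x s]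
    · have : (blowup L y s - lowerSum L y) / L y = arctanSigmoid (L y * s) := by
        rw [blowup]
        field_simp
        ring
      rw [this, yoccozShift_arctanSigmoid (div_pos (hL' y) hy)]
      have h3 : L' y / L y * (L y * s) = L' y * s := by field_simp
      rw [h3]
      simp
      field_simp
    · rw [yoccozShift_of_nonpos]
      · simp [h.not_gt, h.ne']
      · refine div_nonpos_of_nonpos_of_nonneg ?_ hy.le
        linarith [lowerSum_add_le_of_lt hL hs h, blowup_lt hL x s]
  rw [h2, blowup, blowup]
  ring

/-- The derivatives of the summands have disjoint supports, so the tail of their series is bounded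
by a supremum rather than a sum. Since `L' x / L x → 1`, these suprema tend to 0, the series
converges uniformly, and it can be differentiated term by term. -/
theorem contDiff_blowupShift (hL : ∀ x, 0 < L x) (hL' : ∀ x, 0 < L' x) (hs : Summable L)
    (hs' : Summable L') (hlim : Tendsto (fun x => L' x / L x) cofinite (𝓝 1)) :
    ContDiff ℝ 1 (blowupShift L L') := by
  set d : X → ℝ → ℝ := fun x t => yoccozDensity (L' x / L x) ((t - lowerSum L x) / L x) with hd
  have hκ : ∀ x, 0 < L' x / L x := fun x => div_pos (hL' x) (hL x)
  have hd0 : ∀ x t, d x t ≠ 0 → lowerSum L x < t ∧ t < lowerSum L x + L x := by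
    intro x t h
    have hx := hL x
    constructor
    · by_contra! h'
      exact h (yoccozDensity_of_nonpos _ (div_nonpos_of_nonpos_of_nonneg (by linarith) hx.le))
    · by_contra! h'
      exact h (yoccozDensity_of_one_le _ ((one_le_div hx).2 (by linarith)))
  have huniq : ∀ x y t, d x t ≠ 0 → d y t ≠ 0 → x = y := by
    intro x y t hx hy
    obtain ⟨h1, h2⟩ := hd0 x t hx
    obtain ⟨h3, h4⟩ := hd0 y t hy
    rcases lt_trichotomy x y with h | h | h
    · linarith [lowerSum_add_le_of_lt hL hs h]
    · exact h
    · linarith [lowerSum_add_le_of_lt hL hs h]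
  have hsmall : ∀ ε : ℝ, 0 < ε → ∀ᶠ x in cofinite, ∀ t, |d x t| < ε := by
    intro ε hε
    have hc : Tendsto (fun κ : ℝ => |κ ^ 2 - 1| / min 1 (κ ^ 2)) (𝓝 1) (𝓝 0) := by
      have : ContinuousAt (fun κ : ℝ => |κ ^ 2 - 1| / min 1 (κ ^ 2)) 1 := by
        refine ContinuousAt.div (by fun_prop) (by fun_prop) (by norm_num)
      simpa [ContinuousAt] using this
    filter_upwards [(hc.comp hlim).eventually (gt_mem_nhds hε)] with x hx t
    exact (abs_yoccozDensity_le (hκ x) _).trans_lt hx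
  have hunif : TendstoUniformly (fun (F : Finset X) t => ∑ x ∈ F, d x t) (fun t => ∑' x, d x t)
      atTop := by
    rw [Metric.tendstoUniformly_iff]
    intro ε hε
    have hfin : {x | ¬ ∀ t, |d x t| < ε}.Finite := hsmall ε hε
    filter_upwards [eventually_ge_atTop hfin.toFinset] with F hF t
    by_cases hact : ∃ x, d x t ≠ 0
    · obtain ⟨x, hx⟩ := hact
      have hoth : ∀ y, y ≠ x → d y t = 0 := fun y hy => by
        by_contra h
        exact hy (huniq _ _ _ h hx)
      rw [tsum_eq_single x fun y hy => hoth y hy]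
      by_cases hxF : x ∈ F
      · rw [Finset.sum_eq_single_of_mem x hxF fun y _ hy => hoth y hy, dist_self]
        exact hε
      · rw [Finset.sum_eq_zero fun y hy => hoth y fun h => hxF (h ▸ hy), dist_zero_right]
        have : x ∉ {x | ¬ ∀ t, |d x t| < ε} := fun h => hxF (hF (hfin.mem_toFinset.2 h))
        simp only [mem_ofPred_eq, not_not] at this
        exact this t
    · push Not at hact
      simpa [hact] using hε
  have hderiv : ∀ t, HasDerivAt (blowupShift L L') (∑' x, d x t) t := by
    refine hasDerivAt_of_tendstoUniformly (f := fun (F : Finset X) t =>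
      ∑ x ∈ F, L x * yoccozShift (L' x / L x) ((t - lowerSum L x) / L x)) hunif
      (Eventually.of_forall fun F t => HasDerivAt.fun_sum fun x _ => ?_) fun t => ?_
    · have hx := hL x
      have h1 : HasDerivAt (fun t => (t - lowerSum L x) / L x) (1 / L x) t :=
        ((hasDerivAt_id t).sub_const _).div_const _
      have h2 := ((hasDerivAt_yoccozShift (hκ x) ((t - lowerSum L x) / L x)).comp t h1).const_mul
        (L x)
      refine h2.congr_deriv ?_
      simp only [hd]
      field_simp
    · refine Summable.hasSum (Summable.of_norm_bounded (hs'.add hs) fun x => ?_)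
      have hx := hL x
      rw [norm_mul, Real.norm_of_nonneg hx.le]
      calc _ ≤ L x * (L' x / L x + 1) := by
            gcongr
            exact abs_yoccozShift_le (hκ x) _
        _ = L' x + L x := by field_simp
  have hcont : Continuous fun t => ∑' x, d x t := by
    refine hunif.continuous (Eventually.of_forall fun F => ?_).frequently
    refine continuous_finsetSum _ fun x _ => ?_
    have hx := (hL x).ne'
    exact (continuous_yoccozDensity (hκ x)).comp (by fun_prop)
  rw [contDiff_one_iff_deriv]
  refine ⟨fun t => (hderiv t).differentiableAt, ?_⟩
  rwa [funext fun t => (hderiv t).deriv]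

end Blowup

/-! ### From maps on a dense family to `C^1` actions -/

section DenseAction

variable {G : Type*} [Group G] {X : Type*} [MulAction G X]

/-- Continuous self-maps of a Hausdorff space which permute equivariantly a dense family of points
form an action. -/
lemma exists_perm_hom_of_denseRange {Y M : Type*} [TopologicalSpace M] [T2Space M]
    (T : X → Y → M) (hT : DenseRange fun p : X × Y => T p.1 p.2) (f : G → M → M)
    (hf : ∀ g, Continuous (f g)) (hfT : ∀ g x s, f g (T x s) = T (g • x) s) :
    ∃ ρ : G →* Equiv.Perm M, ∀ g, ⇑(ρ g) = f g := by
  have h1 : f 1 = id := hT.equalizer (hf 1) continuous_id <| by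
    ext p
    simp [hfT]
  have hmul : ∀ g h, f (g * h) = f g ∘ f h := fun g h =>
    hT.equalizer (hf _) ((hf g).comp (hf h)) <| by
      ext p
      simp [hfT, mul_smul]
  let _ : MulAction G M :=
    { smul := f
      one_smul := fun m => congrFun h1 m
      mul_smul := fun g h m => congrFun (hmul g h) m }
  exact ⟨MulAction.toPermHom G M, fun g => rfl⟩

/-- The inverse of `ρ g` is `ρ g⁻¹`, so regularity of the inverse comes for free. -/
lemma isC1Action_of_contMDiff {E : Type*} [NormedAddCommGroup E] [NormedSpace ℝ E]
    {H : Type*} [TopologicalSpace H] (I : ModelWithCorners ℝ E H)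
    {M : Type*} [TopologicalSpace M] [ChartedSpace H M] (ρ : G →* Equiv.Perm M)
    (h : ∀ g, ContMDiff I I 1 (ρ g)) : IsC1Action I ρ := fun g =>
  ⟨{ toEquiv := ρ g
     contMDiff_toFun := h g
     contMDiff_invFun := by
      have := h g⁻¹
      rwa [map_inv] at this }, rfl⟩

end DenseAction

/-! ### The action on the interval -/

section Interval

variable {G : Type*} [Group G] {X : Type*} [MulAction G X] [LinearOrder X]

/-- Reindex by `g`, which maps the points below `x` onto those below `g • x`. Thus pulling back the
weight only relabels positions. -/
lemma lowerSum_comp_smul (hmono : ∀ (g : G) (x y : X), x < y → g • x < g • y) (L : X → ℝ) (g : G)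
    (x : X) : lowerSum (fun y => L (g • y)) x = lowerSum L (g • x) := by
  have hiff : ∀ y, g • y < g • x ↔ y < x := fun y =>
    ⟨fun h => by simpa using hmono g⁻¹ _ _ h, hmono g y x⟩
  rw [lowerSum, lowerSum, ← (MulAction.toPerm g).tsum_eq ((Iio (g • x)).indicator L)]
  congr 1
  ext y
  simp [indicator, hiff]

theorem exists_interval_action [Countable X] {L : X → ℝ} (hL : ∀ x, 0 < L x) (hs : HasSum L 1)
    (hlim : ∀ g : G, Tendsto (fun x => L (g • x) / L x) cofinite (𝓝 1))
    (hmono : ∀ (g : G) (x y : X), x < y → g • x < g • y) :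
    ∃ ρ : G →* Equiv.Perm (Set.Icc (0 : ℝ) 1), IsC1Action (𝓡∂ 1) ρ ∧
      ∃ i : X → Set.Icc (0 : ℝ) 1, (∀ x y : X, x < y → i x < i y) ∧
        ∀ (g : G) (x : X), i (g • x) = ρ g (i x) := by
  have hsg : ∀ g : G, HasSum (fun x => L (g • x)) 1 := fun g =>
    (MulAction.toPerm g).hasSum_iff.2 hs
  set F : G → ℝ → ℝ := fun g t => t + blowupShift L (fun x => L (g • x)) t with hF
  have hFC : ∀ g, ContDiff ℝ 1 (F g) := fun g => contDiff_id.add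
    (contDiff_blowupShift hL (fun _ => hL _) hs.summable (hsg g).summable (hlim g))
  have hFT : ∀ g x s, F g (blowup L x s) = blowup L (g • x) s := by
    intro g x s
    simp only [hF]
    rw [blowup_add_blowupShift hL (fun _ => hL _) hs.summable (hsg g).summable, blowup,
      lowerSum_comp_smul hmono, blowup]
  have hmem : ∀ x s, blowup L x s ∈ Icc (0 : ℝ) 1 := fun x s =>
    ⟨(blowup_pos hL x s).le, (blowup_lt_of_hasSum hL hs x s).le⟩
  have hdense := Icc_subset_closure_range_blowup hL hs
  have hFmem : ∀ g, ∀ t ∈ Icc (0 : ℝ) 1, F g t ∈ Icc (0 : ℝ) 1 := by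
    intro g t ht
    -- `F g` permutes the blown-up points, which are dense in `[0, 1]`, so it preserves the closed
    -- interval.
    refine closure_minimal ?_ (isClosed_Icc.preimage (hFC g).continuous) (hdense ht)
    rintro _ ⟨p, rfl⟩
    rw [mem_preimage, hFT]
    exact hmem _ _
  have hcont : ∀ g, Continuous fun t : Icc (0 : ℝ) 1 => (⟨F g t, hFmem g t t.2⟩ : Icc (0 : ℝ) 1) :=
    fun g => ((hFC g).continuous.comp continuous_subtype_val).subtype_mk _
  obtain ⟨ρ, hρ⟩ := exists_perm_hom_of_denseRange (G := G)
    (fun x s => (⟨blowup L x s, hmem x s⟩ : Icc (0 : ℝ) 1)) (by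
      rw [DenseRange, Subtype.dense_iff]
      intro t ht
      rw [← range_comp]
      exact hdense ht)
    (fun g t => ⟨F g t, hFmem g t t.2⟩) hcont fun g x s => Subtype.ext (hFT g x s)
  -- The parameter `s = 0` sends `x` to the midpoint of its interval.
  refine ⟨ρ, isC1Action_of_contMDiff _ ρ fun g => ?_, fun x => ⟨blowup L x 0, hmem x 0⟩,
    fun x y h => blowup_lt_blowup hL hs.summable h 0 0, fun g x => ?_⟩
  · rw [hρ, contMDiff_iff_comp_subtypeVal_Icc]
    exact ⟨hcont g, (hFC g).contMDiff.comp contMDiff_subtypeVal_Icc⟩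
  · rw [hρ]
    exact Subtype.ext (hFT g x 0).symm

end Interval

/-! ### Circular orders: cutting at a point, and the standard order of the circle -/

section CircularOrder

variable {X : Type*}

lemma signType_intCast_injective {a b : SignType} (h : (a : ℤ) = b) : a = b := by
  revert a b
  decide

namespace IsCircularOrder

variable {c : X → X → X → SignType}

lemma self_left (hc : IsCircularOrder c) (x y : X) : c x x y = 0 := (hc.eq_zero_iff _ _ _).2 (Or.inl rfl)

lemma self_right (hc : IsCircularOrder c) (x y : X) : c x y y = 0 := (hc.eq_zero_iff _ _ _).2 (Or.inr (Or.inl rfl))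

lemma self_outer (hc : IsCircularOrder c) (x y : X) : c x y x = 0 := (hc.eq_zero_iff _ _ _).2 (Or.inr (Or.inr rfl))

lemma rotate (hc : IsCircularOrder c) (x y z : X) : c x y z = c y z x := by
  have h := hc.cocycle x y z x
  rw [hc.self_outer, hc.self_outer] at h
  exact signType_intCast_injective (by simp at h; linarith)

lemma swap (hc : IsCircularOrder c) (x y z : X) : c x z y = -c x y z := by
  have h := hc.cocycle x y z y
  rw [hc.self_outer, hc.self_right] at h
  revert h
  generalize c x z y = a
  generalize c x y z = b
  revert a b
  decide

/-- Cutting a circular order at a point `x₀` gives a linear order with least element `x₀`. -/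
lemma exists_linearOrder (hc : IsCircularOrder c) (x₀ : X) : ∃ _ : LinearOrder X, (∀ x, x₀ ≤ x) ∧
    ∀ x y z, x < y → y < z → c x y z = 1 := by
  classical
  let r : X → X → Prop := fun x y => (x = x₀ ∧ y ≠ x₀) ∨ c x₀ x y = 1
  -- The cocycle relation at `x₀, x, y, z` gives `c x y z + c x₀ x z = 2`, so both values are 1.
  have key : ∀ x y z, c x₀ x y = 1 → c x₀ y z = 1 → c x₀ x z = 1 ∧ c x y z = 1 := by
    intro x y z h1 h2
    have h := hc.cocycle x₀ x y z
    rw [h1, h2] at h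
    revert h
    generalize c x y z = a
    generalize c x₀ x z = b
    revert a b
    decide
  have hne : ∀ x y, c x₀ x y = 1 → x ≠ x₀ ∧ y ≠ x₀ := by
    intro x y h
    constructor
    · rintro rfl
      rw [hc.self_left] at h
      exact absurd h (by decide)
    · rintro rfl
      rw [hc.self_outer] at h
      exact absurd h (by decide)
  have : IsStrictTotalOrder X r :=
    { trichotomous := by
        intro x y h1 h2
        simp only [r, not_or, not_and, not_not] at h1 h2
        by_contra hxy
        by_cases hx : x = x₀
        · exact hxy (hx.trans (h1.1 hx).symm)
        by_cases hy : y = x₀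
        · exact hxy ((h2.1 hy).trans hy.symm)
        have h3 : c x₀ x y ≠ 0 := by
          rw [Ne, hc.eq_zero_iff]
          tauto
        have h4 := hc.swap x₀ x y
        have h5 := h1.2
        have h6 := h2.2
        revert h3 h4 h5 h6
        generalize c x₀ x y = a
        generalize c x₀ y x = b
        revert a b
        decide
      irrefl := by
        rintro x (⟨h1, h2⟩ | h)
        · exact h2 h1
        · rw [hc.self_right] at h
          exact absurd h (by decide)
      trans := by
        rintro x y z (⟨hx, hy⟩ | h1) (⟨hy', hz⟩ | h2)
        · exact absurd hy' hy
        · exact Or.inl ⟨hx, (hne _ _ h2).2⟩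
        · exact absurd hy' (hne _ _ h1).2
        · exact Or.inr (key _ _ _ h1 h2).1 }
  refine ⟨linearOrderOfSTO r, fun x => ?_, ?_⟩
  · by_cases h : x = x₀
    · exact Or.inl h.symm
    · exact Or.inr (Or.inl ⟨rfl, h⟩)
  · rintro x y z (⟨rfl, hy⟩ | h1) (⟨hy', hz⟩ | h2)
    · exact absurd hy' hy
    · exact h2
    · exact absurd hy' (hne _ _ h1).2
    · exact (key _ _ _ h1 h2).2

/-- Distinct `x, y, z` have an increasing rotation or a decreasing one; the latter would give value
1 to the reversed triple, contradicting `swap`. -/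
lemma eq_one_iff [LinearOrder X] (hc : IsCircularOrder c)
    (hlin : ∀ x y z, x < y → y < z → c x y z = 1) (x y z : X) :
    c x y z = 1 ↔ (x < y ∧ y < z) ∨ (y < z ∧ z < x) ∨ (z < x ∧ x < y) := by
  constructor
  · intro h
    have hxy : x ≠ y := by
      rintro rfl
      rw [hc.self_left] at h
      exact absurd h (by decide)
    have hyz : y ≠ z := by
      rintro rfl
      rw [hc.self_right] at h
      exact absurd h (by decide)
    have hxz : x ≠ z := by
      rintro rfl
      rw [hc.self_outer] at h
      exact absurd h (by decide)
    have hs : c x z y ≠ 1 := by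
      rw [hc.swap, h]
      decide
    have h1 : ¬ (x < z ∧ z < y) := fun h' => hs (hlin _ _ _ h'.1 h'.2)
    have h2 : ¬ (z < y ∧ y < x) := fun h' => hs (by rw [hc.rotate]; exact hlin _ _ _ h'.1 h'.2)
    have h3 : ¬ (y < x ∧ x < z) := fun h' => hs (by
      rw [hc.rotate, hc.rotate]; exact hlin _ _ _ h'.1 h'.2)
    rcases lt_or_gt_of_ne hxy with a | a <;> rcases lt_or_gt_of_ne hyz with b | b <;>
      rcases lt_or_gt_of_ne hxz with d | d <;> simp_all [lt_asymm]
  · rintro (⟨h1, h2⟩ | ⟨h1, h2⟩ | ⟨h1, h2⟩)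
    · exact hlin _ _ _ h1 h2
    · rw [hc.rotate]
      exact hlin _ _ _ h1 h2
    · rw [hc.rotate, hc.rotate]
      exact hlin _ _ _ h1 h2

end IsCircularOrder

/-- Two alternating functions agree if they agree on increasing triples. -/
lemma eq_of_alternating [LinearOrder X] {c d : X → X → X → SignType}
    (hc : ∀ x y z, c x y z = c y z x) (hc' : ∀ x y z, c x z y = -c x y z)
    (hd : ∀ x y z, d x y z = d y z x) (hd' : ∀ x y z, d x z y = -d x y z)
    (h : ∀ x y z, x < y → y < z → c x y z = d x y z) (x y z : X) : c x y z = d x y z := by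
  have hzero : ∀ {e : X → X → X → SignType}, (∀ x y z, e x z y = -e x y z) →
      ∀ x y, e x y y = 0 := by
    intro e he x y
    have := he x y y
    revert this
    generalize e x y y = a
    revert a
    decide
  have hle : ∀ x y z, x < y → x < z → c x y z = d x y z := by
    intro x y z hxy hxz
    rcases lt_trichotomy y z with h1 | rfl | h1
    · exact h _ _ _ hxy h1
    · rw [hzero hc', hzero hd']
    · rw [hc', hd', h _ _ _ hxz h1]
  have hdeg : ∀ x y, c x y y = d x y y := fun x y => by rw [hzero hc', hzero hd']
  rcases lt_trichotomy x y with h1 | rfl | h1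
  · rcases lt_trichotomy x z with h2 | rfl | h2
    · exact hle _ _ _ h1 h2
    · rw [← hc x x y, ← hd x x y, hc, hd, hc, hd]
      exact hdeg _ _
    · rw [← hc z x y, ← hd z x y]
      exact hle _ _ _ h2 (h2.trans h1)
  · rw [← hc z x x, ← hd z x x]
    exact hdeg _ _
  · rcases lt_trichotomy y z with h2 | rfl | h2
    · rw [hc, hd]
      exact hle _ _ _ h2 h1
    · exact hdeg _ _
    · rw [← hc z x y, ← hd z x y]
      exact hle _ _ _ (h2.trans h1) h2

lemma circleOrder_rotate (z₁ z₂ z₃ : Circle) :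
    circleOrder z₁ z₂ z₃ = circleOrder z₂ z₃ z₁ := by
  rw [circleOrder, circleOrder]
  congr 1
  simp
  ring

lemma circleOrder_swap (z₁ z₂ z₃ : Circle) :
    circleOrder z₁ z₃ z₂ = -circleOrder z₁ z₂ z₃ := by
  rw [circleOrder, circleOrder, ← Left.sign_neg]
  congr 1
  simp
  ring

/-- The determinant factors as four times the product of the sines of the three half-differences,
all of which lie in `(0, π)`. -/
lemma circleOrder_exp {a b c : ℝ} (hab : a < b) (hbc : b < c) (hca : c < a + 2 * Real.pi) :
    circleOrder (Circle.exp a) (Circle.exp b) (Circle.exp c) = 1 := by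
  rw [circleOrder, sign_eq_one_iff]
  have him : ((starRingEnd ℂ) ((Circle.exp b : ℂ) - (Circle.exp a : ℂ)) *
      ((Circle.exp c : ℂ) - (Circle.exp a : ℂ))).im =
      (Real.cos b - Real.cos a) * (Real.sin c - Real.sin a) -
        (Real.sin b - Real.sin a) * (Real.cos c - Real.cos a) := by
    simp [Circle.coe_exp, Complex.exp_ofReal_mul_I_re, Complex.exp_ofReal_mul_I_im]
    ring
  have h4 : Real.sin ((c - b) / 2) = Real.sin ((c + a) / 2) * Real.cos ((b + a) / 2) -
      Real.cos ((c + a) / 2) * Real.sin ((b + a) / 2) := by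
    rw [← Real.sin_sub]
    congr 1
    ring
  have hmul : (Real.cos b - Real.cos a) * (Real.sin c - Real.sin a) -
        (Real.sin b - Real.sin a) * (Real.cos c - Real.cos a) =
      4 * Real.sin ((b - a) / 2) * Real.sin ((c - b) / 2) * Real.sin ((c - a) / 2) := by
    rw [h4, Real.cos_sub_cos, Real.cos_sub_cos, Real.sin_sub_sin, Real.sin_sub_sin]
    ring
  rw [him, hmul]
  have h1 : 0 < Real.sin ((b - a) / 2) :=
    Real.sin_pos_of_pos_of_lt_pi (by linarith) (by linarith)
  have h2 : 0 < Real.sin ((c - b) / 2) :=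
    Real.sin_pos_of_pos_of_lt_pi (by linarith) (by linarith)
  have h3 : 0 < Real.sin ((c - a) / 2) :=
    Real.sin_pos_of_pos_of_lt_pi (by linarith) (by linarith)
  positivity

end CircularOrder

/-! ### Descending functions from the line to the circle -/

section Circle

lemma contMDiffAt_arg_circle {n : WithTop ℕ∞} {z : Circle} (hz : (z : ℂ) ∈ Complex.slitPlane) :
    ContMDiffAt (𝓡 1) 𝓘(ℝ, ℝ) n (fun z : Circle => (z : ℂ).arg) z := by
  have : Fact (Module.finrank ℝ ℂ = 1 + 1) := finrank_real_complex_fact'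
  have h1 : ContDiffAt ℝ n Complex.arg (z : ℂ) := by
    have h2 : ContDiffAt ℝ n Complex.log (z : ℂ) := (Complex.contDiffAt_log hz).restrict_scalars ℝ
    have h3 := Complex.imCLM.contDiff.contDiffAt.comp (z : ℂ) h2
    exact h3.congr_of_eventuallyEq (Eventually.of_forall fun w => (Complex.log_im w).symm)
  have h4 : ContMDiff (𝓡 1) 𝓘(ℝ, ℂ) n (fun z : Circle => (z : ℂ)) := contMDiff_coe_sphere
  exact h1.contMDiffAt.comp z h4.contMDiffAt

lemma contMDiffAt_arg_neg_circle {n : WithTop ℕ∞} {z : Circle}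
    (hz : -(z : ℂ) ∈ Complex.slitPlane) :
    ContMDiffAt (𝓡 1) 𝓘(ℝ, ℝ) n (fun z : Circle => (-(z : ℂ)).arg) z := by
  have hneg : ∀ w : Circle, ((w * Circle.exp Real.pi : Circle) : ℂ) = -w := by
    intro w
    rw [Circle.coe_mul, Circle.coe_exp, Complex.exp_pi_mul_I, mul_neg_one]
  have h1 : ContMDiff (𝓡 1) (𝓡 1) n (fun w : Circle => w * Circle.exp Real.pi) :=
    (contMDiff_mul_right (I := 𝓡 1) (n := ⊤) (a := Circle.exp Real.pi)).of_le le_top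
  have h2 := (contMDiffAt_arg_circle (n := n) (z := z * Circle.exp Real.pi)
    (by rwa [hneg])).comp z h1.contMDiffAt
  refine h2.congr_of_eventuallyEq (Eventually.of_forall fun w => ?_)
  simp only [Function.comp, hneg]

lemma arg_neg_circle (z : Circle) :
    (-(z : ℂ)).arg = if 0 < (z : ℂ).arg then (z : ℂ).arg - Real.pi else (z : ℂ).arg + Real.pi := by
  have hexp : ∀ s : ℝ, s = Real.pi ∨ s = -Real.pi →
      -(z : ℂ) = (Circle.exp ((z : ℂ).arg + s) : ℂ) := by
    rintro s (rfl | rfl)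
    · rw [Circle.exp_add, Circle.exp_arg, Circle.coe_mul, Circle.coe_exp, Complex.exp_pi_mul_I,
        mul_neg_one]
    · rw [Circle.exp_add, Circle.exp_arg, Circle.coe_mul, Circle.coe_exp, Complex.ofReal_neg,
        neg_mul, Complex.exp_neg, Complex.exp_pi_mul_I, inv_neg, inv_one, mul_neg_one]
  have h1 := Complex.neg_pi_lt_arg z
  have h2 := Complex.arg_le_pi z
  have := Real.pi_pos
  split_ifs with h
  · rw [hexp (-Real.pi) (Or.inr rfl), Circle.arg_exp (by linarith) (by linarith), sub_eq_add_neg]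
  · rw [hexp Real.pi (Or.inl rfl), Circle.arg_exp (by linarith) (by linarith)]

/-- A `C^n` function on `ℝ` supported in `[0, 1]` descends to a `C^n` function on the circle, cut
at `-1`. -/
lemma contMDiff_comp_arg_circle {n : WithTop ℕ∞} {h : ℝ → ℝ} (hh : ContDiff ℝ n h)
    (h0 : ∀ t ≤ 0, h t = 0) (h1 : ∀ t, 1 ≤ t → h t = 0) :
    ContMDiff (𝓡 1) 𝓘(ℝ, ℝ) n
      (fun z : Circle => h (((z : ℂ).arg + Real.pi) / (2 * Real.pi))) := by
  have hpi := Real.pi_pos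
  intro z
  rcases Complex.mem_slitPlane_or_neg_mem_slitPlane z.coe_ne_zero with hz | hz
  · have h2 : ContDiff ℝ n fun t : ℝ => h ((t + Real.pi) / (2 * Real.pi)) :=
      hh.comp (by fun_prop)
    exact h2.contMDiff.contMDiffAt.comp z (contMDiffAt_arg_circle hz)
  -- Near `-1` the smooth coordinate is `t = arg (-z)`. The two summands are the branches on either
  -- side of the cut; by the support hypotheses the wrong branch contributes 0.
  · have h2 : ContDiff ℝ n fun t : ℝ => h (t / (2 * Real.pi)) + h (1 + t / (2 * Real.pi)) :=
      (hh.comp (by fun_prop)).add (hh.comp (by fun_prop))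
    refine (h2.contMDiff.contMDiffAt.comp z (contMDiffAt_arg_neg_circle hz)).congr_of_eventuallyEq
      (Eventually.of_forall fun w => ?_)
    have h3 := Complex.neg_pi_lt_arg w
    have h4 := Complex.arg_le_pi w
    simp only [Function.comp, arg_neg_circle]
    split_ifs with hw
    · rw [h0 (((w : ℂ).arg - Real.pi) / (2 * Real.pi))
        (div_nonpos_of_nonpos_of_nonneg (by linarith) (by linarith)), zero_add]
      congr 1
      field_simp
      ring
    · rw [h1 (1 + ((w : ℂ).arg + Real.pi) / (2 * Real.pi)), add_zero]
      have : 0 ≤ ((w : ℂ).arg + Real.pi) / (2 * Real.pi) :=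
        div_nonneg (by linarith) (by linarith)
      linarith

end Circle

/-! ### The action on the circle -/

section CircleAction

variable {G : Type*} [Group G] {X : Type*} [MulAction G X] [LinearOrder X]

/-- Since `g` maps the arc `[x₀, x)` onto the cyclic arc `[g • x₀, g • x)`, both sides count how
often `g • y` is met when running from `x₀` to `g • x₀` and on to `g • x`. The last term on the
right is the full turn made when this passes `x₀` again. -/
lemma ite_lt_add_ite_lt {c : X → X → X → SignType} (hc : IsCircularOrder c)
    (hinv : ∀ (g : G) (x y z : X), c (g • x) (g • y) (g • z) = c x y z) {x₀ : X}
    (hx₀ : ∀ x, x₀ ≤ x) (hlin : ∀ x y z, x < y → y < z → c x y z = 1) (l : ℝ) (g : G) (x y : X) :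
    (if g • y < g • x₀ then l else 0) + (if y < x then l else 0) =
      (if g • y < g • x then l else 0) + if g • x < g • x₀ then l else 0 := by
  by_cases hx : x = x₀
  · subst hx
    simp [(hx₀ y).not_gt]
  have hxlt : x₀ < x := lt_of_le_of_ne (hx₀ x) (Ne.symm hx)
  have hgx : g • x ≠ g • x₀ := fun h => hx (MulAction.injective g h)
  by_cases hy : y = x₀
  · subst hy
    rcases lt_or_gt_of_ne hgx with h | h
    · simp [hxlt, h, h.not_gt]
    · simp [hxlt, h, h.not_gt]
  by_cases hyx : y = x
  · subst hyx
    simp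
  have hylt : x₀ < y := lt_of_le_of_ne (hx₀ y) (Ne.symm hy)
  have hgy : g • y ≠ g • x₀ := fun h => hy (MulAction.injective g h)
  have hgyx : g • y ≠ g • x := fun h => hyx (MulAction.injective g h)
  -- For these points `y < x` means `c x₀ y x = 1`, a condition that `g` preserves.
  have hiff : y < x ↔ (g • x₀ < g • y ∧ g • y < g • x) ∨ (g • y < g • x ∧ g • x < g • x₀) ∨
      (g • x < g • x₀ ∧ g • x₀ < g • y) := by
    rw [← hc.eq_one_iff hlin, hinv, hc.eq_one_iff hlin]
    simp [hylt, hxlt.not_gt]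
  rw [if_congr hiff rfl rfl]
  generalize g • x₀ = a at *
  generalize g • x = b at *
  generalize g • y = d at *
  grind

/-- Up to an integer, an action preserving the circular order shifts the positions `lowerSum` by a
constant. -/
lemma lowerSum_add_lowerSum_comp_smul {c : X → X → X → SignType} (hc : IsCircularOrder c)
    (hinv : ∀ (g : G) (x y z : X), c (g • x) (g • y) (g • z) = c x y z) {x₀ : X}
    (hx₀ : ∀ x, x₀ ≤ x) (hlin : ∀ x y z, x < y → y < z → c x y z = 1) {L : X → ℝ}
    (hs : HasSum L 1) (g : G) (x : X) :
    lowerSum L (g • x₀) + lowerSum (fun y => L (g • y)) x =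
      lowerSum L (g • x) + if g • x < g • x₀ then 1 else 0 := by
  have hsg : HasSum (fun x => L (g • x)) 1 := (MulAction.toPerm g).hasSum_iff.2 hs
  have hlow : ∀ v : X, HasSum (fun y => if g • y < v then L (g • y) else 0) (lowerSum L v) := by
    intro v
    have h := (MulAction.toPerm g).hasSum_iff.2 (hs.summable.indicator (Iio v)).hasSum
    refine (congrArg (fun f => HasSum f (lowerSum L v)) (funext fun y => ?_)).mp h
    simp [indicator]
  have hlow' : HasSum (fun y => if y < x then L (g • y) else 0)
      (lowerSum (fun y => L (g • y)) x) := by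
    have h := (hsg.summable.indicator (Iio x)).hasSum
    refine (congrArg (fun f => HasSum f _) (funext fun y => ?_)).mp h
    simp [indicator]
  have hif : HasSum (fun y => if g • x < g • x₀ then L (g • y) else 0)
      (if g • x < g • x₀ then 1 else 0) := by
    split_ifs
    · exact hsg
    · exact hasSum_zero
  have h1 := (hlow (g • x₀)).add hlow'
  rw [funext fun y => ite_lt_add_ite_lt hc hinv hx₀ hlin (L (g • y)) g x y] at h1
  exact h1.unique ((hlow (g • x)).add hif)

theorem exists_circle_action [Countable X] {L : X → ℝ} (hL : ∀ x, 0 < L x) (hs : HasSum L 1)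
    (hlim : ∀ g : G, Tendsto (fun x => L (g • x) / L x) cofinite (𝓝 1))
    {c : X → X → X → SignType} (hc : IsCircularOrder c)
    (hinv : ∀ (g : G) (x y z : X), c (g • x) (g • y) (g • z) = c x y z) {x₀ : X}
    (hx₀ : ∀ x, x₀ ≤ x) (hlin : ∀ x y z, x < y → y < z → c x y z = 1) :
    ∃ ρ : G →* Equiv.Perm Circle, IsC1Action (𝓡 1) ρ ∧
      ∃ i : X → Circle, Function.Injective i ∧
        (∀ x y z : X, circleOrder (i x) (i y) (i z) = c x y z) ∧
        ∀ (g : G) (x : X), i (g • x) = ρ g (i x) := by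
  have hpi := Real.pi_pos
  have hsg : ∀ g : G, HasSum (fun x => L (g • x)) 1 := fun g =>
    (MulAction.toPerm g).hasSum_iff.2 hs
  -- The shift by `-π` puts the ends of `[0, 1]` at `-1`, where `Complex.arg` is cut.
  set T : X → ℝ → Circle := fun x s => Circle.exp (2 * Real.pi * blowup L x s - Real.pi) with hT
  -- The angle by which `g` turns `z`: a rotation carrying the cut to the start of the interval of
  -- `g • x₀`, plus the displacement, which vanishes at both ends and so descends to the circle.
  set k : G → Circle → ℝ := fun g z => 2 * Real.pi * (lowerSum L (g • x₀) +
    blowupShift L (fun x => L (g • x)) (((z : ℂ).arg + Real.pi) / (2 * Real.pi))) with hk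
  set f : G → Circle → Circle := fun g z => z * Circle.exp (k g z) with hf
  have hkC : ∀ g, ContMDiff (𝓡 1) 𝓘(ℝ, ℝ) 1 (k g) := by
    intro g
    have h1 := contMDiff_comp_arg_circle
      (contDiff_blowupShift hL (fun _ => hL _) hs.summable (hsg g).summable (hlim g))
      (fun t ht => blowupShift_of_nonpos hL ht)
      (fun t ht => blowupShift_of_one_le hL (fun _ => hL _) hs (hsg g) ht)
    have h2 : ContDiff ℝ 1 fun t : ℝ => 2 * Real.pi * (lowerSum L (g • x₀) + t) := by fun_prop
    exact h2.contMDiff.comp h1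
  have hfC : ∀ g, ContMDiff (𝓡 1) (𝓡 1) 1 (f g) := fun g =>
    contMDiff_id.mul (contMDiff_circleExp.comp (hkC g))
  have harg : ∀ x s, ((T x s : ℂ).arg + Real.pi) / (2 * Real.pi) = blowup L x s := by
    intro x s
    have h0 := blowup_pos hL x s
    have h1 := blowup_lt_of_hasSum hL hs x s
    rw [hT]
    dsimp only
    rw [Circle.arg_exp (by nlinarith) (by nlinarith)]
    field_simp
    ring
  have hfT : ∀ g x s, f g (T x s) = T (g • x) s := by
    intro g x s
    simp only [hf, hk]
    rw [harg]
    simp only [hT]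
    rw [← Circle.exp_add]
    have h2 := blowup_add_blowupShift hL (fun y => hL (g • y)) hs.summable (hsg g).summable x s
    have h3 := lowerSum_add_lowerSum_comp_smul hc hinv hx₀ hlin hs g x
    have h4 : 2 * Real.pi * blowup L x s - Real.pi + 2 * Real.pi * (lowerSum L (g • x₀) +
        blowupShift L (fun x => L (g • x)) (blowup L x s)) =
        2 * Real.pi * (blowup L (g • x) s + if g • x < g • x₀ then 1 else 0) - Real.pi := by
      have h5 : blowup L (g • x) s = lowerSum L (g • x) +
        L (g • x) * arctanSigmoid (L (g • x) * s) := rfl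
      have h6 : blowup (fun y => L (g • y)) x s = lowerSum (fun y => L (g • y)) x +
        L (g • x) * arctanSigmoid (L (g • x) * s) := rfl
      linear_combination 2 * Real.pi * (h2 + h3 - h5 + h6)
    rw [h4]
    split_ifs
    · rw [show 2 * Real.pi * (blowup L (g • x) s + 1) - Real.pi =
        2 * Real.pi * blowup L (g • x) s - Real.pi + 2 * Real.pi by ring, Circle.periodic_exp]
    · rw [add_zero]
  have hdense : DenseRange fun p : X × ℝ => T p.1 p.2 := by
    intro z
    have hz : Circle.exp (2 * Real.pi * (((z : ℂ).arg + Real.pi) / (2 * Real.pi)) - Real.pi) = z := by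
      rw [mul_div_cancel₀ _ (by positivity), add_sub_cancel_right, Circle.exp_arg]
    have hmem : ((z : ℂ).arg + Real.pi) / (2 * Real.pi) ∈ Icc (0 : ℝ) 1 := by
      have h1 := Complex.neg_pi_lt_arg z
      have h2 := Complex.arg_le_pi z
      refine ⟨div_nonneg (by linarith) (by linarith), (div_le_one (by linarith)).2 (by linarith)⟩
    have hcont : Continuous fun t : ℝ => Circle.exp (2 * Real.pi * t - Real.pi) :=
      Circle.exp.continuous.comp (by fun_prop)
    rw [← hz]
    refine map_mem_closure (f := fun t : ℝ => Circle.exp (2 * Real.pi * t - Real.pi)) hcont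
      (Icc_subset_closure_range_blowup hL hs hmem) ?_
    rintro _ ⟨p, rfl⟩
    exact ⟨p, rfl⟩
  obtain ⟨ρ, hρ⟩ := exists_perm_hom_of_denseRange T hdense f (fun g => (hfC g).continuous) hfT
  refine ⟨ρ, isC1Action_of_contMDiff _ ρ fun g => by rw [hρ]; exact hfC g, fun x => T x 0, ?_, ?_,
    fun g x => by rw [hρ, hfT]⟩
  · have hmono : StrictMono fun x => blowup L x 0 := fun x y h =>
      blowup_lt_blowup hL hs.summable h 0 0
    refine fun x y hxy => hmono.injective ?_
    dsimp only at hxy ⊢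
    rw [← harg, ← harg, hxy]
  refine eq_of_alternating (fun _ _ _ => circleOrder_rotate _ _ _)
    (fun _ _ _ => circleOrder_swap _ _ _) hc.rotate hc.swap fun x y z hxy hyz => ?_
  rw [hlin x y z hxy hyz]
  have h1 := blowup_lt_blowup hL hs.summable hxy 0 0
  have h2 := blowup_lt_blowup hL hs.summable hyz 0 0
  have h3 := blowup_pos hL x 0
  have h4 := blowup_lt_of_hasSum hL hs z 0
  exact circleOrder_exp (by nlinarith) (by nlinarith) (by nlinarith)

end CircleAction

/-! ### Conclusion -/

theorem theorem1p1 {G : Type*} [Group G] [Countable G]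
    (hG : ∀ H : Subgroup G, H.FG → ¬ HasExponentialGrowth H)
    {X : Type*} [Countable X] [MulAction G X] :
    (∀ _ : LinearOrder X, (∀ (g : G) (x y : X), x < y → g • x < g • y) →
      ∃ ρ : G →* Equiv.Perm (Set.Icc (0 : ℝ) 1), IsC1Action (𝓡∂ 1) ρ ∧
        ∃ i : X → Set.Icc (0 : ℝ) 1, Function.Injective i ∧
          (∀ x y : X, x < y → i x < i y) ∧
          ∀ (g : G) (x : X), i (g • x) = ρ g (i x)) ∧
    (∀ c : X → X → X → SignType, IsCircularOrder c →
      (∀ (g : G) (x y z : X), c (g • x) (g • y) (g • z) = c x y z) →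
      ∃ ρ : G →* Equiv.Perm Circle, IsC1Action (𝓡 1) ρ ∧
        ∃ i : X → Circle, Function.Injective i ∧
          (∀ x y z : X, circleOrder (i x) (i y) (i z) = c x y z) ∧
          ∀ (g : G) (x : X), i (g • x) = ρ g (i x)) := by
  -- On an empty `X` no weight has sum 1; the trivial action serves there.
  rcases isEmpty_or_nonempty X with hX | ⟨⟨x₀⟩⟩
  · refine ⟨fun _ _ => ⟨1, isC1Action_of_contMDiff _ _ fun _ => contMDiff_id, isEmptyElim,
      fun x => isEmptyElim x, fun x => isEmptyElim x, fun _ x => isEmptyElim x⟩,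
      fun _ _ _ => ⟨1, isC1Action_of_contMDiff _ _ fun _ => contMDiff_id, isEmptyElim,
      fun x => isEmptyElim x, fun x => isEmptyElim x, fun _ x => isEmptyElim x⟩⟩
  have : Nonempty X := ⟨x₀⟩
  obtain ⟨L, hL, hs, hlim⟩ := exists_asymptotically_invariant_weight (X := X) hG
  constructor
  · intro _ hmono
    obtain ⟨ρ, hρ, i, hi, hequiv⟩ := exists_interval_action hL hs hlim hmono
    have hmon : StrictMono i := fun x y => hi x y
    exact ⟨ρ, hρ, i, hmon.injective, hi, hequiv⟩
  · intro c hc hinv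
    obtain ⟨_, hx₀, hlin⟩ := hc.exists_linearOrder x₀
    exact exists_circle_action hL hs hlim hc hinv hx₀ hlin
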